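/- Assume the continuum hypothesis $2^{\aleph_0}=\aleph_1$. Let $X$ be a set of cardinality $\aleph_1$ and let $\rho$ be a second countable $T_3$ (regular Hausdorff) topology on $X$. Then there is a topology $\tau$ on $X$, finer than $\rho$ (that is, $\rho\subseteq\tau$), such that $(X,\tau)$ is first countable, locally compact, not Lindelöf, and a strong S-space: for every integer $n\ge 1$, the power $X^n$ with the product topology $\tau^n$ is an S-space, i.e. it is regular Hausdorff, it is hereditarily separable (every subspace of it is separable), and it has a non-Lindelöf subspace. -/

import Mathlib

/-- A space is hereditarily separable if every subspace is separable in its subspace topology. -/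
def IsHereditarilySeparable (X : Type*) [TopologicalSpace X] : Prop :=
  ∀ s : Set X, TopologicalSpace.SeparableSpace s

/-- An S-space is a regular Hausdorff hereditarily separable space with a non-Lindelöf subspace. -/
structure IsSSpace (X : Type*) [TopologicalSpace X] : Prop where
  t3 : T3Space X
  hereditarilySeparable : IsHereditarilySeparable X
  exists_not_lindelof : ∃ s : Set X, ¬ LindelofSpace s

/-- A strong S-space is a space each of whose finite powers is an S-space. The zeroth power is a
point and is never an S-space, so the exponents are the positive ones. -/
def IsStrongSSpace (X : Type*) [TopologicalSpace X] : Prop :=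
  ∀ n : ℕ, 0 < n → IsSSpace (Fin n → X)

open Set Filter Topology TopologicalSpace

/-! Well-order `X` in type ω₁ and use CH to list the countable subsets of each power as `E n a`, `a
: X`. By recursion on `ν`, the new neighbourhoods of `ν` are `ν` together with tails of a sequence
of earlier compact open sets that shrinks to `ν` in `ρ`. Only countably many slices of earlier `E n
a` matter at `ν`, so the sequence can meet every one that accumulates at `ν` (`exists_isLadder`).
Neighbourhoods are countable, so `X` is not Lindelöf. In a power, this preserves membership in the
closure of `E n a` at points with distinct, large coordinates (`mem_closure_of_isLadder`). All other
points lie on countably many copies of the previous power, so hereditary separability follows by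
induction on the exponent. -/

/-! ### Sets all of whose subsets are separable -/

/-- Every subset of `A` has a countable dense subset. -/
def HereditarilySeparableOn {Y : Type*} [TopologicalSpace Y] (A : Set Y) : Prop :=
  ∀ B ⊆ A, ∃ D ⊆ B, D.Countable ∧ B ⊆ closure D

theorem HereditarilySeparableOn.iUnion {Y ι : Type*} [TopologicalSpace Y] [Countable ι]
    {A : ι → Set Y} (h : ∀ i, HereditarilySeparableOn (A i)) :
    HereditarilySeparableOn (⋃ i, A i) := by
  intro B hB
  choose D hDB hD hBD using fun i => h i (B ∩ A i) inter_subset_right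
  refine ⟨⋃ i, D i, iUnion_subset fun i => (hDB i).trans inter_subset_left,
    countable_iUnion hD, fun x hx => ?_⟩
  obtain ⟨i, hi⟩ := mem_iUnion.1 (hB hx)
  exact closure_mono (subset_iUnion D i) (hBD i ⟨hx, hi⟩)

theorem HereditarilySeparableOn.union {Y : Type*} [TopologicalSpace Y] {A B : Set Y}
    (hA : HereditarilySeparableOn A) (hB : HereditarilySeparableOn B) :
    HereditarilySeparableOn (A ∪ B) := by
  rw [union_eq_iUnion]
  exact .iUnion fun b => by cases b <;> assumption

theorem HereditarilySeparableOn.range {Y Z : Type*} [TopologicalSpace Y] [TopologicalSpace Z]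
    (h : HereditarilySeparableOn (univ : Set Z)) {f : Z → Y} (hf : Continuous f) :
    HereditarilySeparableOn (range f) := by
  intro B hB
  obtain ⟨D, hDB, hD, hBD⟩ := h (f ⁻¹' B) (subset_univ _)
  refine ⟨f '' D, image_subset_iff.2 hDB, hD.image f, fun x hx => ?_⟩
  obtain ⟨z, rfl⟩ := hB hx
  exact image_closure_subset_closure_image hf ⟨z, hBD hx, rfl⟩

theorem HereditarilySeparableOn.isHereditarilySeparable {Y : Type*} [TopologicalSpace Y]
    (h : HereditarilySeparableOn (univ : Set Y)) : IsHereditarilySeparable Y := by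
  intro s
  obtain ⟨D, hDs, hD, hsD⟩ := h s (subset_univ _)
  refine ⟨⟨(↑) ⁻¹' D, hD.preimage Subtype.val_injective, fun x => ?_⟩⟩
  rw [Topology.IsInducing.subtypeVal.closure_eq_preimage_closure_image, mem_preimage,
    Subtype.image_preimage_coe, inter_eq_right.2 hDs]
  exact hsD x.2

/-! ### Topologies given by neighbourhood bases of open sets -/

/-- `V x k`, `k : ℕ`, is a decreasing sequence of sets containing `x`, each of which contains
some `V y m` around each of its points `y`. -/
structure IsOpenNhdSystem {X : Type*} (V : X → ℕ → Set X) : Prop where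
  mem : ∀ x k, x ∈ V x k
  antitone : ∀ x, Antitone (V x)
  exists_subset : ∀ x k, ∀ y ∈ V x k, ∃ m, V y m ⊆ V x k

namespace IsOpenNhdSystem

variable {X : Type*} {V : X → ℕ → Set X}

/-- The topology in which the sets `V x k` form a neighbourhood basis at `x`. -/
@[reducible] def topology (hV : IsOpenNhdSystem V) : TopologicalSpace X where
  IsOpen U := ∀ x ∈ U, ∃ k, V x k ⊆ U
  isOpen_univ := fun _ _ => ⟨0, subset_univ _⟩
  isOpen_inter := by
    rintro s t hs ht x ⟨hxs, hxt⟩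
    obtain ⟨k, hk⟩ := hs x hxs
    obtain ⟨l, hl⟩ := ht x hxt
    exact ⟨max k l, subset_inter ((hV.antitone x (le_max_left k l)).trans hk)
      ((hV.antitone x (le_max_right k l)).trans hl)⟩
  isOpen_sUnion := by
    rintro S hS x ⟨s, hs, hxs⟩
    obtain ⟨k, hk⟩ := hS s hs x hxs
    exact ⟨k, hk.trans (subset_sUnion_of_mem hs)⟩

theorem isOpen (hV : IsOpenNhdSystem V) (x : X) (k : ℕ) : IsOpen[hV.topology] (V x k) :=
  hV.exists_subset x k

theorem hasBasis_nhds (hV : IsOpenNhdSystem V) (x : X) :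
    (@nhds X hV.topology x).HasBasis (fun _ : ℕ => True) (V x) := by
  let := hV.topology
  refine ⟨fun U => ⟨fun hU => ?_, ?_⟩⟩
  · obtain ⟨O, hOU, hO, hx⟩ := mem_nhds_iff.1 hU
    obtain ⟨k, hk⟩ := hO x hx
    exact ⟨k, trivial, hk.trans hOU⟩
  · rintro ⟨k, -, hk⟩
    exact mem_of_superset ((hV.isOpen x k).mem_nhds (hV.mem x k)) hk

theorem firstCountableTopology (hV : IsOpenNhdSystem V) :
    @FirstCountableTopology X hV.topology :=
  @FirstCountableTopology.mk X hV.topology fun x => (hV.hasBasis_nhds x).isCountablyGenerated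

theorem topology_le (hV : IsOpenNhdSystem V) (ρ : TopologicalSpace X)
    (h : ∀ x, ∀ O ∈ 𝓝 x, ∃ k, V x k ⊆ O) : hV.topology ≤ ρ :=
  fun _ hU x hx => h x _ (hU.mem_nhds hx)

theorem locallyCompactSpace (hV : IsOpenNhdSystem V)
    (h : ∀ x k, @IsCompact X hV.topology (V x k)) : @LocallyCompactSpace X hV.topology := by
  let := hV.topology
  exact .of_hasBasis hV.hasBasis_nhds fun x k _ => h x k

end IsOpenNhdSystem

/-! ### The recursive construction -/

/-- The `i`-th coordinates of those points of `S` whose other coordinates lie in the sets `W j`. -/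
def boxSlice {X : Type*} {n : ℕ} (S : Set (Fin n → X)) (i : Fin n) (W : Fin n → Set X) : Set X :=
  {x | ∃ s ∈ S, s i = x ∧ ∀ j ≠ i, s j ∈ W j}

/-- The slices of the sets `E n a`, `a < ν`, by boxes whose sides belong to `b` or are of the form
`V y m` with `y < ν`. -/
def slicesBelow {X : Type*} [LT X] (V : X → ℕ → Set X) (b : Set (Set X))
    (E : ∀ n : ℕ, X → Set (Fin n → X)) (ν : X) : Set (Set X) :=
  {C | ∃ n, ∃ a < ν, ∃ (i : Fin n) (W : Fin n → Set X),
    (∀ j, W j ∈ b ∨ ∃ y < ν, ∃ m, V y m = W j) ∧ boxSlice (E n a) i W = C}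

theorem countable_slicesBelow {X : Type*} [LT X] (V : X → ℕ → Set X) {b : Set (Set X)}
    (hb : b.Countable) (E : ∀ n : ℕ, X → Set (Fin n → X)) {ν : X} (hν : {y | y < ν}.Countable) :
    (slicesBelow V b E ν).Countable := by
  have : Countable {y | y < ν} := hν.to_subtype
  have hB : (b ∪ range fun q : {y | y < ν} × ℕ => V q.1 q.2).Countable :=
    hb.union (countable_range _)
  have : (⋃ n : ℕ, ⋃ a : {y | y < ν}, ⋃ i : Fin n, boxSlice (E n a) i ''
      univ.pi fun _ => b ∪ range fun q : {y | y < ν} × ℕ => V q.1 q.2).Countable :=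
    countable_iUnion fun n => countable_iUnion fun a => countable_iUnion fun i =>
      (countable_univ_pi fun _ => hB).image _
  refine this.mono ?_
  rintro C ⟨n, a, ha, i, W, hW, rfl⟩
  simp only [mem_iUnion]
  refine ⟨n, ⟨a, ha⟩, i, W, fun j _ => (hW j).imp_right ?_, rfl⟩
  rintro ⟨y, hy, m, h⟩
  exact ⟨⟨⟨y, hy⟩, m⟩, h⟩

/-- The sequence `g` is a neighbourhood base at `ν` put together from a sequence of sets `V y m`
with `y < ν` which converges to `ν`, such that `ν` becomes a limit of `C ∩ Iio ν` for all
`C ∈ F` for which it is one already. -/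
def IsLadder {X : Type*} [TopologicalSpace X] [Preorder X] (V : X → ℕ → Set X)
    (F : Set (Set X)) (ν : X) (g : ℕ → Set X) : Prop :=
  ∃ K : ℕ → Set X, (∀ j, K j = ∅ ∨ ∃ y < ν, ∃ m, K j = V y m) ∧
    (∀ k, g k = {ν} ∪ ⋃ j ≥ k, K j) ∧ (∀ O ∈ 𝓝 ν, ∃ k, g k ⊆ O) ∧
    ∀ C ∈ F, ν ∈ closure (C ∩ Iio ν) → ∀ k, (g k ∩ (C ∩ Iio ν)).Nonempty

/-- Diagonalization: the accumulating members of `F` are listed, and `Nat.unpair` makes each recur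
infinitely often, so every tail meets it. -/
theorem exists_isLadder {X : Type*} [TopologicalSpace X] [FirstCountableTopology X] [Preorder X]
    {V : X → ℕ → Set X} {F : Set (Set X)} (hF : F.Countable) {ν : X}
    (hmem : ∀ y < ν, ∀ m, y ∈ V y m) (hV : ∀ y < ν, ∀ O ∈ 𝓝 y, ∃ m, V y m ⊆ O) :
    ∃ g, IsLadder V F ν g := by
  obtain ⟨O, hO⟩ := (𝓝 ν).exists_antitone_basis
  have key : ∀ K : ℕ → Set X, (∀ j, K j ⊆ interior (O j)) →
      ∀ U ∈ 𝓝 ν, ∃ k, {ν} ∪ ⋃ j ≥ k, K j ⊆ U := by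
    intro K hK U hU
    obtain ⟨k, -, hk⟩ := hO.1.mem_iff.1 hU
    refine ⟨k, union_subset (singleton_subset_iff.2 (mem_of_mem_nhds hU)) ?_⟩
    exact iUnion₂_subset fun j hj =>
      ((hK j).trans interior_subset).trans ((hO.2 hj).trans hk)
  obtain hG | hG := {C ∈ F | ν ∈ closure (C ∩ Iio ν)}.eq_empty_or_nonempty
  · refine ⟨_, fun _ => ∅, fun _ => .inl rfl, fun _ => rfl, key _ fun _ => empty_subset _, ?_⟩
    intro C hC hν
    exact (eq_empty_iff_forall_notMem.1 hG C ⟨hC, hν⟩).elim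
  · obtain ⟨c, hc⟩ := (hF.mono (sep_subset _ _)).exists_eq_range hG
    have hc' : ∀ k, ν ∈ closure (c k ∩ Iio ν) := fun k =>
      (hc.symm ▸ mem_range_self k : c k ∈ {C ∈ F | ν ∈ closure (C ∩ Iio ν)}).2
    have : ∀ j : ℕ, ∃ y ∈ c j.unpair.1 ∩ Iio ν, ∃ m, V y m ⊆ interior (O j) := by
      intro j
      obtain ⟨y, hyO, hy⟩ := mem_closure_iff_nhds.1 (hc' j.unpair.1) _
        (interior_mem_nhds.2 (hO.1.mem_of_mem trivial))
      obtain ⟨m, hm⟩ := hV y hy.2 _ (isOpen_interior.mem_nhds hyO)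
      exact ⟨y, hy, m, hm⟩
    choose y hy m hm using this
    refine ⟨_, fun j => V (y j) (m j), fun j => .inr ⟨y j, (hy j).2, m j, rfl⟩, fun _ => rfl,
      key _ hm, fun C hC hν k => ?_⟩
    obtain ⟨l, rfl⟩ : C ∈ range c := hc ▸ ⟨hC, hν⟩
    refine ⟨y (Nat.pair l k), .inr ?_, ?_⟩
    · exact mem_iUnion₂.2 ⟨_, Nat.right_le_pair l k, hmem _ (hy _).2 _⟩
    · simpa using hy (Nat.pair l k)

/-- `Q` is the invariant that keeps the recursion from getting stuck. By `hcongr` the default values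
used at and above `ν` are harmless. -/
theorem exists_wellFounded_recursion {X : Type*} [LT X] [WellFoundedLT X] {β : Type*}
    [Inhabited β] (P : (X → β) → X → β → Prop)
    (hcongr : ∀ V V' ν g, (∀ y < ν, V y = V' y) → P V ν g → P V' ν g)
    (Q : X → β → Prop) (hPQ : ∀ V ν g, (∀ y < ν, Q y (V y)) → P V ν g → Q ν g)
    (hP : ∀ V ν, (∀ y < ν, Q y (V y)) → ∃ g, P V ν g) : ∃ V, ∀ ν, P V ν (V ν) := by
  classical
  let ext : ∀ ν, (∀ y, y < ν → β) → X → β := fun ν f y => if h : y < ν then f y h else default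
  let step : ∀ ν, (∀ y, y < ν → β) → β := fun ν f => Classical.epsilon (P (ext ν f) ν)
  let V : X → β := (wellFounded_lt (α := X)).fix step
  have hV : ∀ ν, V ν = step ν fun y _ => V y := (wellFounded_lt (α := X)).fix_eq step
  have hext : ∀ ν, ∀ y < ν, ext ν (fun y _ => V y) y = V y := fun ν y h => by simp [ext, h]
  have hstep : ∀ ν, (∀ y < ν, Q y (V y)) → P V ν (V ν) := by
    intro ν hQ
    refine hcongr _ _ _ _ (hext ν) ?_
    rw [hV ν]
    refine Classical.epsilon_spec (hP _ ν fun y hy => ?_)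
    rw [hext ν y hy]
    exact hQ y hy
  have hQ : ∀ ν, Q ν (V ν) := fun ν => by
    induction ν using WellFoundedLT.induction with
    | ind ν ih => exact hPQ V ν _ ih (hstep ν ih)
  exact ⟨V, fun ν => hstep ν fun y _ => hQ y⟩

theorem slicesBelow_congr {X : Type*} [LT X] {V V' : X → ℕ → Set X} (b : Set (Set X))
    (E : ∀ n : ℕ, X → Set (Fin n → X)) {ν : X} (h : ∀ y < ν, V y = V' y) :
    slicesBelow V b E ν = slicesBelow V' b E ν := by
  have (A : Set X) : (∃ y < ν, ∃ m, V y m = A) ↔ ∃ y < ν, ∃ m, V' y m = A :=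
    exists_congr fun y => and_congr_right fun hy => by rw [h y hy]
  simp only [slicesBelow, this]

theorem exists_ladder_system {X : Type*} [TopologicalSpace X] [FirstCountableTopology X]
    [Preorder X] [WellFoundedLT X] (hctbl : ∀ ν : X, (Iio ν).Countable) {b : Set (Set X)}
    (hb : b.Countable) (E : ∀ n : ℕ, X → Set (Fin n → X)) :
    ∃ V : X → ℕ → Set X, ∀ ν, IsLadder V (slicesBelow V b E ν) ν (V ν) := by
  refine exists_wellFounded_recursion (fun V ν g => IsLadder V (slicesBelow V b E ν) ν g) ?_
    (fun ν g => (∀ m, ν ∈ g m) ∧ ∀ O ∈ 𝓝 ν, ∃ m, g m ⊆ O) ?_ ?_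
  · rintro V V' ν g h ⟨K, hK, hg, hO, hC⟩
    refine ⟨K, fun j => (hK j).imp_right ?_, hg, hO, slicesBelow_congr b E h ▸ hC⟩
    rintro ⟨y, hy, m, e⟩
    exact ⟨y, hy, m, h y hy ▸ e⟩
  · rintro V ν g - ⟨K, -, hg, hO, -⟩
    exact ⟨fun m => hg m ▸ .inl rfl, hO⟩
  · intro V ν h
    exact exists_isLadder (countable_slicesBelow V hb E (hctbl ν)) (fun y hy => (h y hy).1)
      fun y hy => (h y hy).2

/-! ### Properties of the topology -/

section Ladder

variable {X : Type*} {V : X → ℕ → Set X}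

theorem isOpenNhdSystem_of_isLadder [TopologicalSpace X] [Preorder X] [WellFoundedLT X]
    {F : X → Set (Set X)} (h : ∀ ν, IsLadder V (F ν) ν (V ν)) : IsOpenNhdSystem V where
  mem x k := by
    obtain ⟨K, -, hg, -⟩ := h x
    exact hg k ▸ .inl rfl
  antitone x k l hkl := by
    obtain ⟨K, -, hg, -⟩ := h x
    rw [hg, hg]
    exact union_subset_union_right _ (biUnion_subset_biUnion_left fun j hj => hkl.trans hj)
  exists_subset x := by
    induction x using WellFoundedLT.induction with
    | ind x ih =>
      intro k y hy
      obtain ⟨K, hK, hg, -⟩ := h x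
      have hy' := hy
      rw [hg] at hy'
      obtain rfl | hy' := hy'
      · exact ⟨k, subset_rfl⟩
      · obtain ⟨j, hj, hyj⟩ := mem_iUnion₂.1 hy'
        have hsub : K j ⊆ V x k := hg k ▸ (subset_biUnion_of_mem (u := K) hj).trans subset_union_right
        obtain hj0 | ⟨z, hz, m, e⟩ := hK j
        · simp [hj0] at hyj
        · obtain ⟨l, hl⟩ := ih z hz m y (e ▸ hyj)
          exact ⟨l, (e ▸ hl).trans hsub⟩

theorem subset_Iic_of_isLadder [TopologicalSpace X] [Preorder X] [WellFoundedLT X]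
    {F : X → Set (Set X)} (h : ∀ ν, IsLadder V (F ν) ν (V ν)) (x : X) (k : ℕ) :
    V x k ⊆ Iic x := by
  induction x using WellFoundedLT.induction generalizing k with
  | ind x ih =>
    obtain ⟨K, hK, hg, -⟩ := h x
    rw [hg]
    refine union_subset (singleton_subset_iff.2 self_mem_Iic) (iUnion₂_subset fun j _ => ?_)
    obtain hj | ⟨z, hz, m, e⟩ := hK j
    · simp [hj]
    · exact e ▸ (ih z hz m).trans (Iic_subset_Iic.2 hz.le)

theorem isCompact_of_isLadder [TopologicalSpace X] [Preorder X] [WellFoundedLT X]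
    {F : X → Set (Set X)} (h : ∀ ν, IsLadder V (F ν) ν (V ν)) (hV : IsOpenNhdSystem V)
    (x : X) (k : ℕ) : @IsCompact X hV.topology (V x k) := by
  induction x using WellFoundedLT.induction generalizing k with
  | ind x ih =>
    obtain ⟨K, hK, hg, -⟩ := h x
    let := hV.topology
    have hKc (j) : IsCompact (K j) := by
      obtain hj | ⟨z, hz, m, e⟩ := hK j
      · exact hj ▸ isCompact_empty
      · exact e ▸ ih z hz m
    refine isCompact_of_finite_subcover fun {ι} U hU hcov => ?_
    -- The member covering `x` swallows a tail, leaving finitely many compact `K j`.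
    obtain ⟨i, hi⟩ := mem_iUnion.1 (hcov (hV.mem x k))
    obtain ⟨m, hm⟩ := hU i x hi
    have hfin : IsCompact (⋃ j ∈ Ico k m, K j) := (finite_Ico k m).isCompact_biUnion fun j _ => hKc j
    obtain ⟨t, ht⟩ := hfin.elim_finite_subcover U hU <| Subset.trans
      (by rw [hg]; exact (biUnion_subset_biUnion_left fun j hj => hj.1).trans subset_union_right)
      hcov
    classical
    refine ⟨insert i t, fun y hy => ?_⟩
    rw [hg] at hy
    rw [Finset.set_biUnion_insert]
    by_cases hym : y ∈ V x m
    · exact .inl (hm hym)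
    · rw [hg] at hym
      obtain rfl | hy := hy
      · exact (hym (.inl rfl)).elim
      · obtain ⟨j, hj, hyj⟩ := mem_iUnion₂.1 hy
        refine .inr (ht (mem_iUnion₂.2 ⟨j, ⟨hj, ?_⟩, hyj⟩))
        by_contra! hmj
        exact hym (.inr (mem_iUnion₂.2 ⟨j, hmj, hyj⟩))

theorem not_lindelofSpace_of_subset_Iic [Uncountable X] [Preorder X]
    (hctbl : ∀ ν : X, (Iic ν).Countable) (hV : IsOpenNhdSystem V)
    (hsub : ∀ x k, V x k ⊆ Iic x) : ¬ @LindelofSpace X hV.topology := by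
  let := hV.topology
  intro hL
  obtain ⟨t, ht, hcov⟩ := countable_cover_nhds fun x => (hV.isOpen x 0).mem_nhds (hV.mem x 0)
  refine not_countable_univ (α := X) ?_
  rw [← hcov]
  exact ht.biUnion fun x _ => (hctbl x).mono (hsub x 0)

theorem exists_upperBound_of_countable [Uncountable X] [LinearOrder X]
    (hctbl : ∀ ν : X, (Iic ν).Countable) {s : Set X} (hs : s.Countable) : ∃ μ, ∀ x ∈ s, x < μ := by
  by_contra! H
  refine not_countable_univ (α := X) ((hs.biUnion fun x _ => hctbl x).mono fun μ _ => ?_)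
  obtain ⟨x, hx, hμ⟩ := H μ
  exact mem_iUnion₂.2 ⟨x, hx, hμ⟩

/-- A point with distinct coordinates, all above `a` and above the coordinates of the points of
`E n a`, is in the closure of `E n a` for the product of the new topology if it is so for the
product of the old one. -/
theorem mem_closure_of_isLadder [TopologicalSpace X] [LinearOrder X] [WellFoundedLT X]
    {b : Set (Set X)} (hb : IsTopologicalBasis b) {E : ∀ n : ℕ, X → Set (Fin n → X)}
    (h : ∀ ν, IsLadder V (slicesBelow V b E ν) ν (V ν)) {n : ℕ} {a : X} {p : Fin n → X}
    (hp : p.Injective) (ha : ∀ j, a < p j) (hE : ∀ s ∈ E n a, ∀ i j, s i < p j)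
    (hcl : p ∈ closure (E n a)) (k : Fin n → ℕ) : ∃ s ∈ E n a, ∀ j, s j ∈ V (p j) (k j) := by
  -- Old neighbourhoods are traded for new ones one coordinate at a time, in increasing order of `p
  -- j`; `T` holds those already traded.
  suffices H : ∀ (T : Finset (Fin n)) (U : Fin n → Set X), (∀ j ∈ T, ∃ m, V (p j) m ⊆ U j) →
      (∀ j ∉ T, U j ∈ 𝓝 (p j)) → ∃ s ∈ E n a, ∀ j, s j ∈ U j from
    H Finset.univ _ (fun j _ => ⟨k j, subset_rfl⟩) (by simp)
  intro T
  refine Finset.induction_on_max_value p T ?_ ?_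
  · intro U _ hU
    obtain ⟨s, hsU, hs⟩ := mem_closure_iff_nhds.1 hcl (univ.pi U)
      (set_pi_mem_nhds finite_univ fun j _ => hU j (by simp))
    exact ⟨s, hs, fun j => hsU j trivial⟩
  · intro i T hiT hmax ih U hUT hU
    have hW : ∀ j, ∃ W, (W ∈ b ∨ ∃ y < p i, ∃ m, V y m = W) ∧ (j ≠ i → W ⊆ U j) ∧
        (j ∈ T → ∃ m, V (p j) m ⊆ W) ∧ (j ∉ T → W ∈ 𝓝 (p j)) := by
      intro j
      by_cases hj : j ∈ T
      · obtain ⟨m, hm⟩ := hUT j (Finset.mem_insert_of_mem hj)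
        have hne : j ≠ i := fun e => hiT (e ▸ hj)
        exact ⟨V (p j) m, .inr ⟨p j, (hmax j hj).lt_of_ne (hp.ne hne), m, rfl⟩, fun _ => hm,
          fun _ => ⟨m, subset_rfl⟩, fun h => (h hj).elim⟩
      · have : (if j = i then univ else U j) ∈ 𝓝 (p j) := by
          split_ifs with hji
          · exact univ_mem
          · exact hU j (by simp [hji, hj])
        obtain ⟨W, hWb, hpW, hWU⟩ := hb.mem_nhds_iff.1 this
        exact ⟨W, .inl hWb, fun hji => by simpa [hji] using hWU, fun h => (hj h).elim,
          fun _ => hb.mem_nhds hWb hpW⟩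
    choose W hWb hWU hWT hWn using hW
    obtain ⟨m, hm⟩ := hUT i (Finset.mem_insert_self i T)
    obtain ⟨-, -, -, -, hcatch⟩ := h (p i)
    -- As `p i` is the largest traded coordinate, the other sides are basic or come from earlier
    -- points, so this slice was handled at stage `p i`. The induction hypothesis, with any old
    -- neighbourhood as side `i`, shows that it accumulates at `p i`.
    obtain ⟨x, hxV, ⟨s, hs, rfl, hsW⟩, -⟩ := hcatch (boxSlice (E n a) i W)
      ⟨n, a, ha i, i, W, hWb, rfl⟩ (mem_closure_iff_nhds.2 fun O hO => by
        obtain ⟨s, hs, hsU⟩ := ih (Function.update W i O)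
          (fun j hj => by
            rw [Function.update_of_ne (ne_of_mem_of_not_mem hj hiT)]
            exact hWT j hj)
          (fun j hj => by
            by_cases hji : j = i
            · subst hji; simpa using hO
            · rw [Function.update_of_ne hji]
              exact hWn j hj)
        refine ⟨s i, by simpa using hsU i, ⟨s, hs, rfl, fun j hj => ?_⟩, hE s hs i i⟩
        simpa [hj] using hsU j) m
    refine ⟨s, hs, fun j => ?_⟩
    by_cases hji : j = i
    · subst hji; exact hm hxV
    · exact hWU j hji (hsW j hji)

theorem hereditarilySeparableOn_pi_of_isLadder [ρ : TopologicalSpace X]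
    [SecondCountableTopology X] [Uncountable X] [LinearOrder X] [WellFoundedLT X]
    (hctbl : ∀ ν : X, (Iic ν).Countable)
    {b : Set (Set X)} (hb : IsTopologicalBasis b) {E : ∀ n : ℕ, X → Set (Fin n → X)}
    (hE : ∀ n, ∀ D : Set (Fin n → X), D.Countable → ∃ a, E n a = D)
    (h : ∀ ν, IsLadder V (slicesBelow V b E ν) ν (V ν)) (hV : IsOpenNhdSystem V) (n : ℕ) :
    @HereditarilySeparableOn (Fin n → X) (@Pi.topologicalSpace _ _ fun _ => hV.topology) univ := by
  induction n with
  | zero => exact fun B _ => ⟨B, subset_rfl, B.to_countable, @subset_closure _ (_) _⟩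
  | succ n ih =>
    intro A _
    obtain ⟨D, hDA, hD, hAD⟩ : ∃ D ⊆ A, D.Countable ∧ A ⊆ closure D := by
      obtain ⟨t, ht, hAt⟩ := exists_countable_dense A
      exact ⟨(↑) '' t, Subtype.coe_image_subset A t, ht.image _, Subtype.dense_iff.1 hAt⟩
    obtain ⟨a, ha⟩ := hE _ D hD
    -- Beyond `μ` lie points later than both the index of `D` and all coordinates of its members.
    obtain ⟨μ, hμ⟩ := exists_upperBound_of_countable hctbl
      (s := insert a (⋃ s ∈ D, range s))
      ((hD.biUnion fun s _ => countable_range s).insert a)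
    have hDV : ∀ p ∈ A, p.Injective → (∀ i, μ < p i) → ∀ k : Fin (n + 1) → ℕ,
        ∃ s ∈ E _ a, ∀ j, s j ∈ V (p j) (k j) := fun p hp hinj hpμ =>
      mem_closure_of_isLadder hb h hinj
        (fun j => (hμ a (mem_insert _ _)).trans (hpμ j))
        (fun s hs i j =>
          (hμ _ (.inr (mem_iUnion₂.2 ⟨s, ha ▸ hs, mem_range_self i⟩))).trans (hpμ j))
        (ha.symm ▸ hAD hp)
    let τ := hV.topology
    have : Countable (Iic μ) := (hctbl μ).to_subtype
    have h1 : HereditarilySeparableOn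
        (⋃ i : Fin (n + 1), ⋃ c : Iic μ, range fun q : Fin n → X =>
          (i.insertNth c.1 q : Fin (n + 1) → X)) :=
      .iUnion fun i => .iUnion fun c =>
        ih.range (Continuous.finInsertNth i continuous_const continuous_id)
    have h2 : HereditarilySeparableOn
        (⋃ i : Fin (n + 1), ⋃ k : Fin n, range fun q : Fin n → X =>
          (i.insertNth (q k) q : Fin (n + 1) → X)) :=
      .iUnion fun i => .iUnion fun k =>
        ih.range (Continuous.finInsertNth i (continuous_apply k) continuous_id)
    obtain ⟨D', hD'A, hD', hAD'⟩ := (h1.union h2) _ (inter_subset_right (s := A))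
    refine ⟨D ∪ D', union_subset hDA (hD'A.trans inter_subset_left), hD.union hD', fun p hp => ?_⟩
    by_cases hp' : p ∈ (⋃ i : Fin (n + 1), ⋃ c : Iic μ, range fun q : Fin n → X =>
          (i.insertNth c.1 q : Fin (n + 1) → X)) ∪
        ⋃ i : Fin (n + 1), ⋃ k : Fin n, range fun q : Fin n → X =>
          (i.insertNth (q k) q : Fin (n + 1) → X)
    · exact closure_mono subset_union_right (hAD' ⟨hp, hp'⟩)
    refine closure_mono subset_union_left ?_
    simp only [mem_union, mem_iUnion, not_or, not_exists] at hp'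
    have hpμ : ∀ i, μ < p i := by
      intro i
      by_contra! hi
      exact hp'.1 i ⟨p i, hi⟩ ⟨i.removeNth p, Fin.insertNth_self_removeNth i p⟩
    have hinj : p.Injective := by
      intro i j hij
      by_contra hne
      obtain ⟨k, rfl⟩ := Fin.exists_succAbove_eq (Ne.symm hne)
      refine hp'.2 i k ⟨i.removeNth p, ?_⟩
      change i.insertNth (p (i.succAbove k)) (i.removeNth p) = p
      rw [← hij, Fin.insertNth_self_removeNth]
    refine mem_closure_iff_nhds.2 fun U hU => ?_
    rw [nhds_pi, (hasBasis_pi fun j => hV.hasBasis_nhds (p j)).mem_iff] at hU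
    obtain ⟨⟨I, k⟩, -, hU⟩ := hU
    obtain ⟨s, hs, hsV⟩ := hDV p hp hinj hpμ k
    exact ⟨s, hU fun j _ => hsV j, ha ▸ hs⟩

end Ladder

/-! ### Enumerations from the continuum hypothesis, and the conclusion -/

theorem exists_wellOrder_countable_Iio {X : Type*} (hX : Cardinal.mk X = Cardinal.aleph 1) :
    ∃ _ : LinearOrder X, WellFoundedLT X ∧ ∀ x : X, (Iio x).Countable := by
  obtain ⟨e⟩ : Nonempty (X ≃ (Cardinal.mk X).ord.ToType) :=
    Cardinal.eq.1 (Cardinal.mk_ord_toType _).symm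
  refine ⟨LinearOrder.lift' e e.injective, ⟨InvImage.wf e wellFounded_lt⟩, fun x => ?_⟩
  have : (Iio (e x)).Countable := by
    rw [← Cardinal.le_aleph0_iff_set_countable, ← Cardinal.lt_aleph_one_iff, ← hX]
    simpa using Cardinal.mk_Iio_lt (e x) (by simp)
  exact this.preimage e.injective

theorem exists_enumeration_countable_sets {X Y : Type*} [Nonempty X]
    (h : Nonempty ((ℕ → Option Y) ↪ X)) :
    ∃ E : X → Set Y, ∀ D : Set Y, D.Countable → ∃ a, E a = D := by
  obtain ⟨f⟩ := h
  -- The extra value `none` lets a sequence code the empty set as well.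
  refine ⟨fun a => {y | some y ∈ range (Function.invFun f a)}, fun D hD => ?_⟩
  obtain ⟨c, hc⟩ := (hD.image some |>.insert none).exists_eq_range (insert_nonempty _ _)
  refine ⟨f c, ?_⟩
  beta_reduce
  rw [Function.leftInverse_invFun f.injective, ← hc]
  ext y
  simp

theorem nonempty_embedding_of_continuum {X : Type*} (hX : Cardinal.mk X = Cardinal.continuum)
    (n : ℕ) : Nonempty ((ℕ → Option (Fin n → X)) ↪ X) := by
  have h1 : Cardinal.mk (Option (Fin n → X)) ≤ Cardinal.continuum := by
    rw [Cardinal.mk_option]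
    refine Cardinal.add_le_of_le Cardinal.aleph0_le_continuum ?_
      (Cardinal.nat_lt_continuum 1 |>.le.trans_eq' (by simp))
    simp only [Cardinal.mk_pi, Cardinal.prod_const, hX, Cardinal.mk_fin, Cardinal.lift_natCast,
      Cardinal.lift_continuum]
    exact_mod_cast Cardinal.power_nat_le (n := n) (by simpa using Cardinal.aleph0_le_continuum)
  have h2 : Cardinal.mk (ℕ → Option (Fin n → X)) ≤ Cardinal.mk X := by
    rw [hX, ← Cardinal.continuum_power_aleph0]
    simpa using Cardinal.power_le_power_right (c := Cardinal.aleph0) h1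
  exact h2

theorem theorem2p4 (hCH : Cardinal.continuum.{0} = Cardinal.aleph 1)
    {X : Type*} (hX : Cardinal.mk X = Cardinal.aleph 1)
    (ρ : TopologicalSpace X)
    (hρ_second : @SecondCountableTopology X ρ) (hρ_T3 : @T3Space X ρ) :
    ∃ τ : TopologicalSpace X, τ ≤ ρ ∧
      @FirstCountableTopology X τ ∧ @LocallyCompactSpace X τ ∧
      @IsStrongSSpace X τ ∧ ¬ @LindelofSpace X τ := by
  have hXc : Cardinal.mk X = Cardinal.continuum := by
    rw [hX, ← Cardinal.lift_continuum.{_, 0}, hCH]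
    simp
  have : Uncountable X := by
    rw [← Cardinal.aleph0_lt_mk_iff, hXc]
    exact Cardinal.aleph0_lt_continuum
  obtain ⟨_, _, hIio⟩ := exists_wellOrder_countable_Iio hX
  have hIic : ∀ x : X, (Iic x).Countable := fun x => by
    rw [← Iio_insert]
    exact (hIio x).insert x
  choose E hE using fun n =>
    exists_enumeration_countable_sets (nonempty_embedding_of_continuum hXc n)
  obtain ⟨b, hbc, -, hb⟩ := exists_countable_basis X
  obtain ⟨V, h⟩ := exists_ladder_system hIio hbc E
  have hV := isOpenNhdSystem_of_isLadder h
  have hle : hV.topology ≤ ρ := hV.topology_le ρ fun x => by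
    obtain ⟨_, -, -, hO, -⟩ := h x
    exact hO
  have hLC := hV.locallyCompactSpace (isCompact_of_isLadder h hV)
  have hL := not_lindelofSpace_of_subset_Iic hIic hV (subset_Iic_of_isLadder h)
  refine ⟨hV.topology, hle, hV.firstCountableTopology, hLC, fun n hn => ?_, hL⟩
  have hHS := hereditarilySeparableOn_pi_of_isLadder hIic hb hE h hV n
  have hT2 : @T2Space X hV.topology := t2Space_antitone hle inferInstance
  let := hV.topology
  -- Regularity comes from local compactness and Hausdorffness; a Lindelöf power would project onto
  -- a Lindelöf `X`.
  refine ⟨inferInstance, hHS.isHereditarilySeparable, univ, fun hU => hL ?_⟩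
  have : LindelofSpace (Fin n → X) := ⟨isLindelof_iff_lindelofSpace.2 hU⟩
  exact ⟨by
    rw [← (Function.surjective_eval (β := fun _ => X) (⟨0, hn⟩ : Fin n)).range_eq, ← image_univ]
    exact isLindelof_univ.image (continuous_apply _)⟩
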